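/- **Theorem (asymptotic convergence of simultaneous softmax policy gradient).** Consider a finite-horizon MDP with decision epochs $\mathcal H=\{0,\dots,H-1\}$, $H\ge 1$, finite state space $\mathcal S=\mathcal S_0\cup\dots\cup\mathcal S_{H-1}$, finite action space $\mathcal A=\bigcup_{s\in\mathcal S}\mathcal A_s$ with every $\mathcal A_s$ non-empty, rewards $r(s,a)\in[0,R^*]$ for some $R^*>0$, and transition probabilities $p(\cdot\mid s,a)$ on $\mathcal S$ with $p(\mathcal S_{h+1}\mid s,a)=1$ for $h<H-1$, $s\in\mathcal S_h$, $a\in\mathcal A_s$. (The case $\mathcal S_h=\mathcal S$ for all $h$ is included.) A policy $\pi=(\pi_h)_{h\in\mathcal H}$ assigns to each $s\in\mathcal S_h$ a probability measure $\pi_h(\cdot\mid s)$ on $\mathcal A$ concentrated on $\mathcal A_s$. Its values are $V_h^{\pi}(\nu)=\mathbb E\big[\sum_{k=h}^{H-1} r(S_k,A_k)\big]$, where $S_h\sim\nu$, $A_k\sim\pi_k(\cdot\mid S_k)$, $S_{k+1}\sim p(\cdot\mid S_k,A_k)$; put $V_h^\pi(s)=V_h^\pi(\delta_s)$ and $V_h^*(s)=\sup_\pi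 V_h^\pi(s)$. The enlarged state space $\mathcal S^{[\mathcal H]}$ is the disjoint union of the $\mathcal S_h$; write $s_h$ for the state $s\in\mathcal S_h$ regarded at epoch $h$, and $V^\pi(s_h)=V^\pi_h(s)$, $V^*(s_h)=V^*_h(s)$. For $\theta=(\theta(s_h,a))_{s_h\in\mathcal S^{[\mathcal H]},\,a\in\mathcal A_s}$ let $\pi^\theta(a\mid s_h)=\exp(\theta(s_h,a))/\sum_{a'\in\mathcal A_s}\exp(\theta(s_h,a'))$ be the tabular softmax policy. Let $\mu$ be a probability measure on $\mathcal S_0$ with $\mu(s)>0$ for all $s\in\mathcal S_0$, let $0<\eta\le\frac{1}{5H^2R^*}$, let $\theta^{(0)}$ be arbitrary, and let $$\theta^{(n+1)}=\theta^{(n)}+\eta\,\nabla_\theta V_0^{\pi^\theta}(\mu)\big|_{\theta=\theta^{(n)}},\qquad n\ge 0 .$$ Then $V^{\pi^{\theta^{(n)}}}(s_h)\to V^*(s_h)$ as $n\to\infty$ for every $s_h\in\mathcal S^{[\mathcal H]}$ that is reachable from $\mu$, i.e. such that $\mathbb P_\mu^{\pi}(S_h=s)>0$ for some policy $\pi$.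 In particular, $V_0^{\pi^{\theta^{(n)}}}(s)\to V_0^*(s)$ as $n\to\infty$ for all $s\in\mathcal S_0$. -/

import Mathlib

noncomputable section

open Finset

/-- A Markov decision process with finitely many decision epochs `0, …, horizon - 1`, finite state
space `S = S_0 ∪ ⋯ ∪ S_{horizon - 1}`, finite action space `A = ⋃ₛ A_s`, reward `r(s, a)` and
transition probabilities `p(s' | s, a)`, written `p s a s'`.  Only the values of `states h` with
`h < horizon` matter. -/
structure FiniteHorizonMDP (S A : Type*) [Fintype S] where
  horizon : ℕ
  horizon_pos : 0 < horizon
  states : ℕ → Finset S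
  actions : S → Finset A
  reward : S → A → ℝ
  p : S → A → S → ℝ
  states_cover : ∀ s, ∃ h < horizon, s ∈ states h
  actions_cover : ∀ a, ∃ s, a ∈ actions s
  actions_nonempty : ∀ s, (actions s).Nonempty
  p_mem : ∀ s a, p s a ∈ stdSimplex ℝ S
  p_states : ∀ h, h + 1 < horizon → ∀ s ∈ states h, ∀ a ∈ actions s,
    ∑ s' ∈ states (h + 1), p s a s' = 1

namespace FiniteHorizonMDP

/-- `π h s a` is the probability `π_h(a | s)`.  A time-dependent policy gives, for every epoch `h`
and every `s ∈ S_h`, a probability measure on the actions that is concentrated on `A_s`.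
(The values at states outside `S_h` are irrelevant.) -/
def IsPolicy {S A : Type*} [Fintype S] [Fintype A] (M : FiniteHorizonMDP S A)
    (π : ℕ → S → A → ℝ) : Prop :=
  ∀ h < M.horizon, ∀ s ∈ M.states h, π h s ∈ stdSimplex ℝ A ∧ ∑ a ∈ M.actions s, π h s a = 1

/-- The probability of the trajectory `τ = (s_h, a_h, …, s_{h+n-1}, a_{h+n-1})` of length `n` when
`S_h ∼ ν`, `A_k ∼ π_k(· | S_k)` and `S_{k+1} ∼ p(· | S_k, A_k)`. -/
def trajProb {S A : Type*} [Fintype S] (M : FiniteHorizonMDP S A) (π : ℕ → S → A → ℝ) :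
    (n : ℕ) → (h : ℕ) → (ν : S → ℝ) → (Fin n → S × A) → ℝ
  | 0, _, _, _ => 1
  | n + 1, h, ν, τ =>
      ν (τ 0).1 * π h (τ 0).1 (τ 0).2 *
        trajProb M π n (h + 1) (M.p (τ 0).1 (τ 0).2) (fun k => τ k.succ)

/-- The value `V_h^π(ν)`: the expectation of `∑_{k=h}^{H-1} r(S_k, A_k)` when `S_h ∼ ν` and
the actions follow `π`, as a sum over the finitely many trajectories from epoch `h` to `H - 1`. -/
def value {S A : Type*} [Fintype S] [Fintype A] (M : FiniteHorizonMDP S A)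
    (π : ℕ → S → A → ℝ) (h : ℕ) (ν : S → ℝ) : ℝ :=
  ∑ τ : Fin (M.horizon - h) → S × A,
    M.trajProb π (M.horizon - h) h ν τ * ∑ k, M.reward (τ k).1 (τ k).2

/-- `V_h^π(s) = V_h^π(δ_s)`. -/
def stateValue {S A : Type*} [Fintype S] [DecidableEq S] [Fintype A] (M : FiniteHorizonMDP S A)
    (π : ℕ → S → A → ℝ) (h : ℕ) (s : S) : ℝ :=
  M.value π h (Pi.single s 1)

/-- `V_h^*(s)`, the supremum of `V_h^π(s)` over all policies `π`. -/
def optimalValue {S A : Type*} [Fintype S] [DecidableEq S] [Fintype A] (M : FiniteHorizonMDP S A)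
    (h : ℕ) (s : S) : ℝ :=
  sSup {v | ∃ π : ℕ → S → A → ℝ, M.IsPolicy π ∧ v = M.stateValue π h s}

/-- The state visitation probability `ℙ_μ^π(S_h = s)`, for a process started at time `0`
with `S_0 ∼ μ`. -/
def visitProb {S A : Type*} [Fintype S] [DecidableEq S] [Fintype A] (M : FiniteHorizonMDP S A)
    (π : ℕ → S → A → ℝ) (μ : S → ℝ) (h : Fin M.horizon) (s : S) : ℝ :=
  ∑ τ : Fin M.horizon → S × A, if (τ h).1 = s then M.trajProb π M.horizon 0 μ τ else 0

/-- The enlarged state space, i.e. the disjoint union of the `S_h`; the pair `(h, s)` is the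
state `s` at epoch `h`. -/
def enlargedStates {S A : Type*} [Fintype S] [DecidableEq S] (M : FiniteHorizonMDP S A) :
    Finset (Fin M.horizon × S) :=
  univ.filter fun x => x.2 ∈ M.states x.1

/-- The index set of the tabular parameters: one for each state of the enlarged state space and
each action admissible there. -/
def paramIndex {S A : Type*} [Fintype S] [DecidableEq S] [Fintype A] [DecidableEq A]
    (M : FiniteHorizonMDP S A) : Finset (ℕ × S × A) :=
  (range M.horizon ×ˢ (univ : Finset (S × A))).filter
    fun x => x.2.1 ∈ M.states x.1 ∧ x.2.2 ∈ M.actions x.2.1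

/-- The parameter space `ℝ^{∑_h d_h}` with `d_h = ∑_{s ∈ S_h} |A_s|`. -/
abbrev Param {S A : Type*} [Fintype S] [DecidableEq S] [Fintype A] [DecidableEq A]
    (M : FiniteHorizonMDP S A) : Type _ :=
  EuclideanSpace ℝ M.paramIndex

/-- `exp (θ(s_h, a))` if `s ∈ S_h` and `a ∈ A_s`, and `0` otherwise. -/
def expWeight {S A : Type*} [Fintype S] [DecidableEq S] [Fintype A] [DecidableEq A]
    (M : FiniteHorizonMDP S A) (θ : M.Param) (h : ℕ) (s : S) (a : A) : ℝ :=
  if hx : (h, s, a) ∈ M.paramIndex then Real.exp (θ ⟨(h, s, a), hx⟩) else 0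

/-- The tabular softmax policy `π^θ`. -/
def softmax {S A : Type*} [Fintype S] [DecidableEq S] [Fintype A] [DecidableEq A]
    (M : FiniteHorizonMDP S A) (θ : M.Param) (h : ℕ) (s : S) (a : A) : ℝ :=
  M.expWeight θ h s a / ∑ a' ∈ M.actions s, M.expWeight θ h s a'

/-- The parameters `θ^{(n)}` of simultaneous policy gradient with exact gradients:
`θ^{(n+1)} = θ^{(n)} + η ∇_θ V_0^{π^θ}(μ)|_{θ = θ^{(n)}}`, started at `θ₀`. -/
def simultaneousPG {S A : Type*} [Fintype S] [DecidableEq S] [Fintype A] [DecidableEq A]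
    (M : FiniteHorizonMDP S A) (η : ℝ) (μ : S → ℝ) (θ₀ : M.Param) : ℕ → M.Param
  | 0 => θ₀
  | n + 1 =>
      simultaneousPG M η μ θ₀ n +
        η • gradient (fun θ : M.Param => M.value (M.softmax θ) 0 μ) (simultaneousPG M η μ θ₀ n)

end FiniteHorizonMDP

end

/-!
Write `d_n(s_h)` for the probability of visiting `s` at epoch `h` under the `n`-th softmax policy
`π_n`, and `A_n` for its advantages `Q - V`.  By the policy gradient formula
(`gradient_value_softmax`), the iteration acts at each state `s_h` as a softmax bandit with its own
step size `w_n = η d_n(s_h)`: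
`θ_{n+1}(s_h, a) = θ_n(s_h, a) + w_n π_n(a | s_h) A_n(s_h, a)`, where `∑_a π_n A_n = 0`.

*Monotonicity.*  One such step makes `π_{n+1}` proportional to `π_n exp (w_n π_n A_n)`, so
`∑_a π_{n+1} A_n` is a positive multiple of `∑_a π_n A_n (exp (w_n π_n A_n) - 1) ≥ 0`
(`sum_gibbs_step_mul_nonneg`).  By backward induction the value at every `s_h` is nondecreasing in
`n`, hence convergent, and so are the advantages (`bellmanValue_simultaneousPG_le_succ`).

*Exploration.*  The probability `d_n(s_h)` may tend to `0`, for instance when `s_h` is reached by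
suboptimal actions only.  What survives is `∑_n d_n(s_h) = ∞` for every reachable `s_h`
(`not_summable_occupancy`).  This is proved forward in `h`: if the step sizes at a state have an
infinite sum, then so have the step sizes weighted by the probability of any fixed action
(`not_summable_mul_gibbs`), because `∑_a θ_n(s_h, a)` is conserved and no coordinate can drift to
`-∞` while the total weight of one action is finite.

*Optimality.*  At a state whose step sizes have an infinite sum, the limits of the advantages are
nonpositive (`limit_advantage_nonpos`).  So the limit values satisfy the Bellman optimality
inequality at all reachable states, and backward induction shows that they dominate the values of
every policy there (`bellmanValue_le_limitValue`).
-/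

open Finset

noncomputable section

namespace FiniteHorizonMDP

/-! ### Softmax gradient ascent for a single state -/

/-- The softmax weights `exp (θ a) / ∑_{c ∈ F} exp (θ c)` on a finite set `F`. -/
def gibbs {ι : Type*} (F : Finset ι) (θ : ι → ℝ) (a : ι) : ℝ :=
  Real.exp (θ a) / ∑ c ∈ F, Real.exp (θ c)

section Gibbs

variable {ι : Type*} {F : Finset ι}

lemma sum_exp_pos (hF : F.Nonempty) (θ : ι → ℝ) : 0 < ∑ c ∈ F, Real.exp (θ c) :=
  sum_pos (fun _ _ => Real.exp_pos _) hF

lemma gibbs_pos (hF : F.Nonempty) (θ : ι → ℝ) (a : ι) : 0 < gibbs F θ a :=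
  div_pos (Real.exp_pos _) (sum_exp_pos hF θ)

lemma gibbs_le_one (θ : ι → ℝ) {a : ι} (ha : a ∈ F) : gibbs F θ a ≤ 1 :=
  div_le_one_of_le₀
    (single_le_sum (f := fun c => Real.exp (θ c)) (fun _ _ => (Real.exp_pos _).le) ha)
    (sum_exp_pos ⟨a, ha⟩ θ).le

lemma gibbs_eq_exp_sub_mul (F : Finset ι) (θ : ι → ℝ) (a b : ι) :
    gibbs F θ b = Real.exp (θ b - θ a) * gibbs F θ a := by
  unfold gibbs
  rw [Real.exp_sub]
  field_simp

lemma gibbs_le_gibbs (hF : F.Nonempty) {θ : ι → ℝ} {a b : ι} (h : θ b ≤ θ a) :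
    gibbs F θ b ≤ gibbs F θ a :=
  div_le_div_of_nonneg_right (Real.exp_le_exp.2 h) (sum_exp_pos hF θ).le

/-- A softmax gradient step of any length `w ≥ 0` improves the expected reward: the new weights are
proportional to `π(b) exp (w π(b) A(b))`, and `A(b) (exp (w π(b) A(b)) - 1) ≥ 0`. -/
lemma sum_gibbs_step_mul_nonneg (hF : F.Nonempty) {θ θ' A : ι → ℝ} {w : ℝ} (hw : 0 ≤ w)
    (hθ' : ∀ b ∈ F, θ' b = θ b + w * (gibbs F θ b * A b))
    (hA : ∑ b ∈ F, gibbs F θ b * A b = 0) :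
    0 ≤ ∑ b ∈ F, gibbs F θ' b * A b := by
  have key : 0 ≤ ∑ b ∈ F, gibbs F θ b * A b * Real.exp (w * (gibbs F θ b * A b)) := by
    rw [← hA]
    refine sum_le_sum fun b _ => ?_
    rcases le_total 0 (gibbs F θ b * A b) with h | h
    · exact le_mul_of_one_le_right h (Real.one_le_exp (mul_nonneg hw h))
    · exact le_mul_of_le_one_right h
        (Real.exp_le_one_iff.2 (mul_nonpos_of_nonneg_of_nonpos hw h))
  have hS := sum_exp_pos hF θ
  have hS' := sum_exp_pos hF θ'
  have : ∑ b ∈ F, gibbs F θ' b * A b =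
      (∑ c ∈ F, Real.exp (θ c)) / (∑ c ∈ F, Real.exp (θ' c)) *
        ∑ b ∈ F, gibbs F θ b * A b * Real.exp (w * (gibbs F θ b * A b)) := by
    rw [mul_sum]
    refine sum_congr rfl fun b hb => ?_
    have h1 : Real.exp (θ' b) = Real.exp (θ b) * Real.exp (w * (gibbs F θ b * A b)) := by
      rw [hθ' b hb, Real.exp_add]
    have h2 : gibbs F θ b * (∑ c ∈ F, Real.exp (θ c)) = Real.exp (θ b) := by
      unfold gibbs; field_simp
    rw [gibbs, h1, ← h2]
    field_simp
  rw [this]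
  positivity

/-- Every action keeps being explored: if the step sizes `w n` are not summable, then neither are
the step sizes weighted by the probability of a fixed action `a`.  Otherwise `θ n a` stays bounded;
while `θ n b ≤ 0`, the weight of `b` is at most a constant times that of `a`, so no coordinate
`θ n b` can drift to `-∞`; since the sum of the coordinates is conserved, all of them stay bounded
and the probability of `a` is bounded away from `0`. -/
lemma not_summable_mul_gibbs {θ A : ℕ → ι → ℝ} {w : ℕ → ℝ} {W C : ℝ}
    (hw0 : ∀ n, 0 ≤ w n) (hwW : ∀ n, w n ≤ W)
    (hAC : ∀ n, ∀ b ∈ F, |A n b| ≤ C)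
    (hstep : ∀ n, ∀ b ∈ F, θ (n + 1) b = θ n b + w n * (gibbs F (θ n) b * A n b))
    (hA : ∀ n, ∑ b ∈ F, gibbs F (θ n) b * A n b = 0)
    (hw : ¬ Summable w) {a : ι} (ha : a ∈ F) :
    ¬ Summable fun n => w n * gibbs F (θ n) a := by
  intro hsum
  have hF : F.Nonempty := ⟨a, ha⟩
  set u : ℕ → ℝ := fun n => w n * gibbs F (θ n) a with hu
  have hu0 : ∀ n, 0 ≤ u n := fun n => mul_nonneg (hw0 n) (gibbs_pos hF _ _).le
  have hC : 0 ≤ C := (abs_nonneg _).trans (hAC 0 a ha)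
  have hW : 0 ≤ W := (hw0 0).trans (hwW 0)
  set T := ∑' n, u n with hT
  have hT0 : 0 ≤ T := tsum_nonneg hu0
  have hpart : ∀ n, ∑ k ∈ range n, u k ≤ T := fun n => hsum.sum_le_tsum _ fun k _ => hu0 k
  -- the increment of any coordinate is at most `w π C` in absolute value
  have hinc : ∀ n, ∀ b ∈ F, |θ (n + 1) b - θ n b| ≤ C * (w n * gibbs F (θ n) b) := by
    intro n b hb
    rw [hstep n b hb, add_sub_cancel_left, ← mul_assoc, abs_mul,
      abs_of_nonneg (mul_nonneg (hw0 n) (gibbs_pos hF _ _).le), mul_comm]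
    exact mul_le_mul_of_nonneg_right (hAC n b hb) (mul_nonneg (hw0 n) (gibbs_pos hF _ _).le)
  have hθa : ∀ n, θ 0 a - C * ∑ k ∈ range n, u k ≤ θ n a := by
    intro n
    induction n with
    | zero => simp
    | succ n ih =>
      have := (abs_le.1 (hinc n a ha)).1
      rw [sum_range_succ, mul_add]
      linarith
  set K := C * T - θ 0 a with hK
  have hKa : ∀ n, -θ n a ≤ K := fun n => by
    have := mul_le_mul_of_nonneg_left (hpart n) hC
    linarith [hθa n]
  have hlow : ∀ b ∈ F, ∃ L, ∀ n, L ≤ θ n b := by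
    intro b hb
    set D := C * Real.exp K with hD
    have hD0 : 0 ≤ D := by positivity
    have hind : ∀ n, -(|θ 0 b| + C * W) - D * ∑ k ∈ range n, u k ≤ θ n b := by
      intro n
      induction n with
      | zero =>
        have := neg_abs_le (θ 0 b)
        have : 0 ≤ C * W := by positivity
        simp only [range_zero, sum_empty, mul_zero]
        linarith
      | succ n ih =>
        have h1 := (abs_le.1 (hinc n b hb)).1
        rcases le_total (θ n b) 0 with h0 | h0
        · have h2 : w n * gibbs F (θ n) b ≤ Real.exp K * u n := by
            rw [gibbs_eq_exp_sub_mul F (θ n) a b, hu]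
            have h3 : Real.exp (θ n b - θ n a) ≤ Real.exp K :=
              Real.exp_le_exp.2 (by linarith [hKa n])
            have := mul_le_mul_of_nonneg_right h3 (hu0 n)
            simp only [hu] at this ⊢
            linarith
          have h4 := mul_le_mul_of_nonneg_left h2 hC
          rw [sum_range_succ, mul_add]
          rw [← mul_assoc] at h4
          linarith
        · have h2 : w n * gibbs F (θ n) b ≤ W :=
            (mul_le_of_le_one_right (hw0 n) (gibbs_le_one _ hb)).trans (hwW n)
          have h4 := mul_le_mul_of_nonneg_left h2 hC
          have h5 : 0 ≤ D * ∑ k ∈ range (n + 1), u k :=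
            mul_nonneg hD0 (sum_nonneg fun k _ => hu0 k)
          have := abs_nonneg (θ 0 b)
          linarith
    refine ⟨-(|θ 0 b| + C * W) - D * T, fun n => ?_⟩
    have := mul_le_mul_of_nonneg_left (hpart n) hD0
    linarith [hind n]
  choose! L hL using hlow
  have hcons : ∀ n, ∑ b ∈ F, θ n b = ∑ b ∈ F, θ 0 b := by
    intro n
    induction n with
    | zero => rfl
    | succ n ih =>
      rw [sum_congr rfl (hstep n), sum_add_distrib, ← mul_sum, hA n, mul_zero, add_zero, ih]
  have hup : ∀ b ∈ F, ∀ n, θ n b ≤ ∑ c ∈ F, θ 0 c - ∑ c ∈ F, L c + L b := by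
    intro b hb n
    have h1 : θ n b - L b ≤ ∑ c ∈ F, (θ n c - L c) :=
      single_le_sum (f := fun c => θ n c - L c) (fun c hc => sub_nonneg.2 (hL c hc n)) hb
    rw [sum_sub_distrib, hcons n] at h1
    linarith
  set U := ∑ b ∈ F, Real.exp (∑ c ∈ F, θ 0 c - ∑ c ∈ F, L c + L b) with hU
  have hU0 : 0 < U := sum_pos (fun _ _ => Real.exp_pos _) hF
  have hδ : ∀ n, Real.exp (L a) / U ≤ gibbs F (θ n) a := fun n =>
    div_le_div₀ (Real.exp_pos _).le (Real.exp_le_exp.2 (hL a ha n)) (sum_exp_pos hF _)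
      (sum_le_sum fun b hb => Real.exp_le_exp.2 (hup b hb n))
  have hδ0 : 0 < Real.exp (L a) / U := div_pos (Real.exp_pos _) hU0
  refine hw (Summable.of_nonneg_of_le hw0 (fun n => ?_) (hsum.mul_left (Real.exp (L a) / U)⁻¹))
  have := mul_le_mul_of_nonneg_left (hδ n) (hw0 n)
  rw [inv_mul_eq_div, le_div_iff₀ hδ0]
  exact this

lemma tendsto_atTop_of_not_summable_increments {x u : ℕ → ℝ} {c : ℝ} (hc : 0 < c)
    (hu : ∀ n, 0 ≤ u n) (hsum : ¬ Summable u)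
    (hx : ∀ᶠ n in Filter.atTop, x n + c * u n ≤ x (n + 1)) :
    Filter.Tendsto x Filter.atTop Filter.atTop := by
  obtain ⟨N, hN⟩ := Filter.eventually_atTop.1 hx
  rw [← summable_nat_add_iff N] at hsum
  have h1 := (not_summable_iff_tendsto_nat_atTop_of_nonneg (fun n => hu (n + N))).1 hsum
  have h2 : ∀ n, x N + c * ∑ k ∈ range n, u (k + N) ≤ x (n + N) := by
    intro n
    induction n with
    | zero => simp
    | succ n ih =>
      have := hN (n + N) (Nat.le_add_left _ _)
      rw [sum_range_succ, mul_add, show n + 1 + N = n + N + 1 by ring]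
      linarith
  rw [← Filter.tendsto_add_atTop_iff_nat N]
  exact Filter.tendsto_atTop_mono h2
    (Filter.tendsto_atTop_add_const_left _ _ (h1.const_mul_atTop hc))

/-- Limits of advantages along softmax gradient ascent are nonpositive.  If the limit at `a` is
positive, then `θ n a → ∞`.  Let `B` be the set of the actions `b` with `θ n b > θ n a` for all
large `n`.  Outside `B`, the total of `π A` is eventually positive, as the negative terms are
negligible compared with the probability of `a`; hence the total over `B` is negative, and
`∑_{b ∈ B} θ n b` is eventually nonincreasing although each of its terms exceeds `θ n a`. -/
lemma limit_advantage_nonpos {θ A : ℕ → ι → ℝ} {w : ℕ → ℝ} {W C : ℝ} {Alim : ι → ℝ}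
    (hw0 : ∀ n, 0 ≤ w n) (hwW : ∀ n, w n ≤ W)
    (hAC : ∀ n, ∀ b ∈ F, |A n b| ≤ C)
    (hstep : ∀ n, ∀ b ∈ F, θ (n + 1) b = θ n b + w n * (gibbs F (θ n) b * A n b))
    (hA : ∀ n, ∑ b ∈ F, gibbs F (θ n) b * A n b = 0)
    (hw : ¬ Summable w)
    (hlim : ∀ b ∈ F, Filter.Tendsto (fun n => A n b) Filter.atTop (nhds (Alim b)))
    {a : ι} (ha : a ∈ F) : Alim a ≤ 0 := by
  classical
  by_contra! hpos
  have hF : F.Nonempty := ⟨a, ha⟩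
  have hns : ∀ b ∈ F, ¬ Summable fun n => w n * gibbs F (θ n) b := fun b hb =>
    not_summable_mul_gibbs hw0 hwW hAC hstep hA hw hb
  have hu0 : ∀ b n, 0 ≤ w n * gibbs F (θ n) b := fun b n =>
    mul_nonneg (hw0 n) (gibbs_pos hF _ _).le
  have hAa : ∀ᶠ n in Filter.atTop, Alim a / 2 < A n a :=
    (hlim a ha).eventually_const_lt (by linarith)
  have hθa : Filter.Tendsto (fun n => θ n a) Filter.atTop Filter.atTop := by
    refine tendsto_atTop_of_not_summable_increments (half_pos hpos) (hu0 a) (hns a ha) ?_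
    filter_upwards [hAa] with n hn
    rw [hstep n a ha, ← mul_assoc]
    have := mul_le_mul_of_nonneg_left hn.le (hu0 a n)
    linarith
  set B := F.filter fun b => ∀ᶠ n in Filter.atTop, θ n a < θ n b with hB
  have hBF : B ⊆ F := filter_subset _ _
  have haB : a ∉ B := fun h => by
    obtain ⟨n, hn⟩ := (mem_filter.1 h).2.exists
    exact lt_irrefl _ hn
  set ε := Alim a / (4 * #F) with hε
  have hcard : (0 : ℝ) < #F := by exact_mod_cast hF.card_pos
  have hε0 : 0 < ε := by positivity
  have hout : ∀ b ∈ F \ B, ∀ᶠ n in Filter.atTop,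
      -ε * gibbs F (θ n) a ≤ gibbs F (θ n) b * A n b := by
    intro b hb
    obtain ⟨hbF, hbB⟩ := mem_sdiff.1 hb
    rcases lt_trichotomy (Alim b) 0 with h | h | h
    · -- a negative limit: `θ n b → -∞`, so the odds of `b` against `a` tend to `0`
      have hAb : ∀ᶠ n in Filter.atTop, A n b < Alim b / 2 :=
        (hlim b hbF).eventually_lt_const (by linarith)
      have hθb : Filter.Tendsto (fun n => -θ n b) Filter.atTop Filter.atTop := by
        refine tendsto_atTop_of_not_summable_increments (c := -(Alim b / 2)) (by linarith)
          (hu0 b) (hns b hbF) ?_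
        filter_upwards [hAb] with n hn
        rw [hstep n b hbF, ← mul_assoc]
        have := mul_le_mul_of_nonneg_left hn.le (hu0 b n)
        linarith
      have hC : 0 ≤ C := (abs_nonneg _).trans (hAC 0 a ha)
      have hratio : Filter.Tendsto (fun n => C * Real.exp (θ n b - θ n a)) Filter.atTop
          (nhds 0) := by
        have h1 : Filter.Tendsto (fun n => θ n b - θ n a) Filter.atTop Filter.atBot := by
          rw [← Filter.tendsto_neg_atTop_iff]
          refine (hθb.atTop_add_atTop hθa).congr fun n => by ring
        simpa using (Real.tendsto_exp_atBot.comp h1).const_mul C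
      filter_upwards [hratio.eventually_lt_const hε0] with n hn
      have hga := gibbs_pos hF (θ n) a
      have h2 := mul_le_mul_of_nonneg_left (abs_le.1 (hAC n b hbF)).1 (gibbs_pos hF (θ n) b).le
      rw [gibbs_eq_exp_sub_mul F (θ n) a b] at h2 ⊢
      have h3 := mul_le_mul_of_nonneg_right hn.le hga.le
      linarith
    · -- limit zero: the order `θ n b ≤ θ n a` persists once it holds
      have hcmp : ∀ᶠ n in Filter.atTop, A n b < Alim a / 2 :=
        (hlim b hbF).eventually_lt_const (by linarith)
      obtain ⟨N, hN⟩ := Filter.eventually_atTop.1 (hAa.and hcmp)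
      have hfreq : ∃ n ≥ N, θ n b ≤ θ n a := by
        by_contra! hcon
        exact hbB (mem_filter.2 ⟨hbF, Filter.eventually_atTop.2 ⟨N, hcon⟩⟩)
      obtain ⟨n₀, hn₀, hle₀⟩ := hfreq
      have hle : ∀ n ≥ n₀, θ n b ≤ θ n a := by
        intro n hn
        induction n, hn using Nat.le_induction with
        | base => exact hle₀
        | succ n hn ih =>
          obtain ⟨h1, h2⟩ := hN n (hn₀.le.trans hn)
          rw [hstep n a ha, hstep n b hbF]
          have hgb := gibbs_pos hF (θ n) b
          have hab : gibbs F (θ n) b * A n b ≤ gibbs F (θ n) a * A n a :=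
            (mul_le_mul_of_nonneg_left (h2.trans h1).le hgb.le).trans
              (mul_le_mul_of_nonneg_right (gibbs_le_gibbs hF ih) (by linarith))
          have := mul_le_mul_of_nonneg_left hab (hw0 n)
          linarith
      have hsmall : ∀ᶠ n in Filter.atTop, -ε < A n b :=
        (hlim b hbF).eventually_const_lt (by linarith)
      filter_upwards [hsmall, Filter.eventually_ge_atTop n₀] with n h1 h2
      have h3 := gibbs_le_gibbs hF (hle n h2)
      have h4 := mul_le_mul_of_nonneg_left h1.le (gibbs_pos hF (θ n) b).le
      have h5 := mul_le_mul_of_nonneg_left h3 hε0.le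
      linarith
    · filter_upwards [(hlim b hbF).eventually_const_lt h] with n hn
      have h1 := mul_pos (gibbs_pos hF (θ n) b) hn
      have h2 := mul_pos hε0 (gibbs_pos hF (θ n) a)
      linarith
  have hneg : ∀ᶠ n in Filter.atTop, ∑ b ∈ B, gibbs F (θ n) b * A n b < 0 := by
    filter_upwards [(Filter.eventually_all_finset (F \ B)).2 hout, hAa] with n h1 h2
    have haFB : a ∈ F \ B := mem_sdiff.2 ⟨ha, haB⟩
    have hga := gibbs_pos hF (θ n) a
    have h3 : ∑ b ∈ (F \ B).erase a, (-ε * gibbs F (θ n) a) ≤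
        ∑ b ∈ (F \ B).erase a, gibbs F (θ n) b * A n b :=
      sum_le_sum fun b hb => h1 b (mem_of_mem_erase hb)
    rw [sum_const, nsmul_eq_mul] at h3
    have h4 : (#((F \ B).erase a) : ℝ) ≤ #F := by
      exact_mod_cast card_le_card ((erase_subset _ _).trans sdiff_subset)
    have h5 := mul_le_mul_of_nonneg_right h4 (mul_pos hε0 hga).le
    have h6 : (#F : ℝ) * (ε * gibbs F (θ n) a) = Alim a / 4 * gibbs F (θ n) a := by
      rw [hε]; field_simp
    have h7 := add_sum_erase (F \ B) (fun b => gibbs F (θ n) b * A n b) haFB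
    have h8 := sum_sdiff (f := fun b => gibbs F (θ n) b * A n b) hBF
    rw [hA n] at h8
    have h9 := mul_lt_mul_of_pos_left h2 hga
    have h10 := mul_pos hga hpos
    linarith
  rcases B.eq_empty_or_nonempty with hB0 | hB0
  · obtain ⟨n, hn⟩ := hneg.exists
    simp [hB0] at hn
  · obtain ⟨N, hN⟩ := Filter.eventually_atTop.1 hneg
    have hmono : ∀ n ≥ N, ∑ b ∈ B, θ n b ≤ ∑ b ∈ B, θ N b := by
      intro n hn
      induction n, hn using Nat.le_induction with
      | base => exact le_rfl
      | succ n hn ih =>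
        rw [sum_congr rfl fun b hb => hstep n b (hBF hb), sum_add_distrib, ← mul_sum]
        have := mul_nonpos_of_nonneg_of_nonpos (hw0 n) (hN n hn).le
        linarith
    have hcardB : (0 : ℝ) < #B := by exact_mod_cast hB0.card_pos
    have hall : ∀ᶠ n in Filter.atTop, ∀ b ∈ B, θ n a < θ n b :=
      (Filter.eventually_all_finset B).2 fun b hb => (mem_filter.1 hb).2
    obtain ⟨n, h1, h2, h3⟩ := ((hθa.eventually_gt_atTop ((∑ b ∈ B, θ N b) / #B)).and
      (hall.and (Filter.eventually_ge_atTop N))).exists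
    have h4 : ∑ _b ∈ B, θ n a ≤ ∑ b ∈ B, θ n b := sum_le_sum fun b hb => (h2 b hb).le
    rw [sum_const, nsmul_eq_mul] at h4
    rw [div_lt_iff₀ hcardB] at h1
    linarith [hmono n h3]

end Gibbs

/-! ### Bellman recursion, occupancy and reachability -/

section Bellman

lemma eq_zero_of_sum_eq_one {X : Type*} [Fintype X] {f : X → ℝ} (hf : f ∈ stdSimplex ℝ X)
    {T : Finset X} (hT : ∑ x ∈ T, f x = 1) {x : X} (hx : x ∉ T) : f x = 0 := by
  classical
  have h1 := hf.2
  rw [← sum_add_sum_compl T, hT, add_eq_left] at h1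
  exact (sum_eq_zero_iff_of_nonneg fun _ _ => hf.1 _).1 h1 x (mem_compl.2 hx)

lemma p_nonneg {S A : Type*} [Fintype S] (M : FiniteHorizonMDP S A) (s : S) (a : A) (s' : S) :
    0 ≤ M.p s a s' :=
  (M.p_mem s a).1 s'

lemma p_eq_zero_of_notMem {S A : Type*} [Fintype S] (M : FiniteHorizonMDP S A) {h : ℕ}
    (hh : h + 1 < M.horizon) {s : S} (hs : s ∈ M.states h) {a : A} (ha : a ∈ M.actions s) {s' : S}
    (hs' : s' ∉ M.states (h + 1)) : M.p s a s' = 0 :=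
  eq_zero_of_sum_eq_one (M.p_mem s a) (M.p_states h hh s hs a ha) hs'

lemma abs_sum_p_mul_le {S A : Type*} [Fintype S] (M : FiniteHorizonMDP S A) (s : S) (a : A)
    {v : S → ℝ} {B : ℝ} (hv : ∀ s', |v s'| ≤ B) :
    |∑ s', M.p s a s' * v s'| ≤ B := by
  refine (abs_sum_le_sum_abs _ _).trans ?_
  calc ∑ s', |M.p s a s' * v s'| ≤ ∑ s', M.p s a s' * B := by
        refine sum_le_sum fun s' _ => ?_
        rw [abs_mul, abs_of_nonneg (M.p_nonneg s a s')]
        exact mul_le_mul_of_nonneg_left (hv s') (M.p_nonneg s a s')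
    _ = B := by rw [← sum_mul, (M.p_mem s a).2, one_mul]

/-- The states that can be reached at a given epoch with positive probability when all admissible
actions are explored and the initial distribution charges every state of epoch `0`. -/
inductive Reachable {S A : Type*} [Fintype S] (M : FiniteHorizonMDP S A) : ℕ → S → Prop
  | init {s : S} : s ∈ M.states 0 → Reachable M 0 s
  | step {h : ℕ} {s s' : S} {a : A} : Reachable M h s → h + 1 < M.horizon → a ∈ M.actions s →
      M.p s a s' ≠ 0 → Reachable M (h + 1) s'

lemma Reachable.mem_states {S A : Type*} [Fintype S] {M : FiniteHorizonMDP S A} {h : ℕ} {s : S}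
    (hr : M.Reachable h s) : s ∈ M.states h := by
  induction hr with
  | init hs => exact hs
  | step _ hh ha hp ih =>
    by_contra hcon
    exact hp (M.p_eq_zero_of_notMem hh ih ha hcon)

variable {S A : Type*} [Fintype S] [Fintype A]

/-- The value at state `s` and epoch `h` when `n` epochs remain, by backward recursion.  No
assumption is made on `π`, so that the same recursion serves for differences of policies. -/
def bellmanValue (M : FiniteHorizonMDP S A) (π : ℕ → S → A → ℝ) : ℕ → ℕ → S → ℝ
  | 0, _, _ => 0
  | n + 1, h, s =>
      ∑ a, π h s a * (M.reward s a + ∑ s', M.p s a s' * bellmanValue M π n (h + 1) s')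

/-- The state-action value `Q` at epoch `h` when `n` epochs remain after the current one. -/
def actionValue (M : FiniteHorizonMDP S A) (π : ℕ → S → A → ℝ) (n h : ℕ) (s : S) (a : A) : ℝ :=
  M.reward s a + ∑ s', M.p s a s' * M.bellmanValue π n (h + 1) s'

/-- The distribution of the state at epoch `h` under the policy `π`, by forward recursion from the
initial distribution `μ`. -/
def occupancy (M : FiniteHorizonMDP S A) (π : ℕ → S → A → ℝ) (μ : S → ℝ) : ℕ → S → ℝ
  | 0, s => μ s
  | h + 1, s' => ∑ s, ∑ a, occupancy M π μ h s * π h s a * M.p s a s'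

lemma bellmanValue_succ (M : FiniteHorizonMDP S A) (π : ℕ → S → A → ℝ) (n h : ℕ) (s : S) :
    M.bellmanValue π (n + 1) h s = ∑ a, π h s a * M.actionValue π n h s a := rfl

lemma IsPolicy.mem_actions_of_ne_zero {M : FiniteHorizonMDP S A} {π : ℕ → S → A → ℝ}
    (hπ : M.IsPolicy π) {h : ℕ} (hh : h < M.horizon) {s : S} (hs : s ∈ M.states h) {a : A}
    (ha : π h s a ≠ 0) : a ∈ M.actions s := by
  by_contra hcon
  exact ha (eq_zero_of_sum_eq_one (hπ h hh s hs).1 (hπ h hh s hs).2 hcon)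

lemma sum_fin_succ {X : Type*} [Fintype X] {n : ℕ} (f : (Fin (n + 1) → X) → ℝ) :
    ∑ τ, f τ = ∑ x, ∑ τ : Fin n → X, f (Fin.cons x τ) := by
  rw [← Fintype.sum_prod_type']
  exact (Fintype.sum_equiv (Fin.consEquiv fun _ => X) _ _ fun _ => rfl).symm

/-- The trajectory sums satisfy the Bellman recursion.  The two claims are proved together because
the rewards of the first epoch are weighted by the total probability of the remaining trajectory.
With no epochs left, nothing is required of `ν`. -/
lemma trajProb_sum_and_value {M : FiniteHorizonMDP S A} {π : ℕ → S → A → ℝ} (hπ : M.IsPolicy π)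
    (n h : ℕ) (hn : h + n = M.horizon) (ν : S → ℝ)
    (hν : 0 < n → (∀ s, ν s ≠ 0 → s ∈ M.states h) ∧ ∑ s, ν s = 1) :
    ∑ τ, M.trajProb π n h ν τ = 1 ∧
      ∑ τ, M.trajProb π n h ν τ * ∑ k, M.reward (τ k).1 (τ k).2 =
        ∑ s, ν s * M.bellmanValue π n h s := by
  induction n generalizing h ν with
  | zero => simp [trajProb, bellmanValue]
  | succ n ih =>
    obtain ⟨hsupp, hsum⟩ := hν n.succ_pos
    have hh : h < M.horizon := by omega
    -- the continuation after `(s, a)` satisfies the induction hypothesis unless its weight is zero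
    have hnext : ∀ s a, ν s * π h s a ≠ 0 →
        ∑ τ, M.trajProb π n (h + 1) (M.p s a) τ = 1 ∧
        ∑ τ, M.trajProb π n (h + 1) (M.p s a) τ * ∑ k, M.reward (τ k).1 (τ k).2 =
          ∑ s', M.p s a s' * M.bellmanValue π n (h + 1) s' := by
      intro s a hne
      have hs := hsupp s (left_ne_zero_of_mul hne)
      have ha := hπ.mem_actions_of_ne_zero hh hs (right_ne_zero_of_mul hne)
      refine ih (h + 1) (by omega) _ fun hpos => ⟨fun s' hs' => ?_, (M.p_mem s a).2⟩
      by_contra hcon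
      exact hs' (M.p_eq_zero_of_notMem (by omega) hs ha hcon)
    constructor
    · rw [sum_fin_succ]
      simp only [trajProb, Fin.cons_zero, Fin.cons_succ, ← mul_sum]
      rw [Fintype.sum_prod_type, ← hsum]
      refine sum_congr rfl fun s _ => ?_
      have : ∀ a, ν s * π h s a * ∑ τ, M.trajProb π n (h + 1) (M.p s a) τ = ν s * π h s a := by
        intro a
        by_cases hne : ν s * π h s a = 0
        · rw [hne, zero_mul]
        · rw [(hnext s a hne).1, mul_one]
      simp only [this, ← mul_sum]
      by_cases hs : ν s = 0
      · rw [hs, zero_mul]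
      · rw [(hπ h hh s (hsupp s hs)).1.2, mul_one]
    · rw [sum_fin_succ]
      simp only [trajProb, Fin.cons_zero, Fin.cons_succ, Fin.sum_univ_succ]
      rw [Fintype.sum_prod_type]
      refine sum_congr rfl fun s _ => ?_
      rw [bellmanValue_succ, mul_sum]
      refine sum_congr rfl fun a _ => ?_
      by_cases hne : ν s * π h s a = 0
      · simp [← mul_assoc, hne]
      · obtain ⟨h1, h2⟩ := hnext s a hne
        simp only [mul_assoc, ← mul_sum, mul_add, sum_add_distrib]
        rw [← sum_mul, h1, h2, one_mul, actionValue, mul_add, mul_add]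

lemma value_eq_sum_bellmanValue {M : FiniteHorizonMDP S A} {π : ℕ → S → A → ℝ}
    (hπ : M.IsPolicy π) {h : ℕ} (hh : h ≤ M.horizon) {ν : S → ℝ}
    (hsupp : ∀ s, ν s ≠ 0 → s ∈ M.states h) (hsum : ∑ s, ν s = 1) :
    M.value π h ν = ∑ s, ν s * M.bellmanValue π (M.horizon - h) h s :=
  (trajProb_sum_and_value hπ _ h (by omega) ν fun _ => ⟨hsupp, hsum⟩).2

lemma stateValue_eq_bellmanValue [DecidableEq S] {M : FiniteHorizonMDP S A}
    {π : ℕ → S → A → ℝ} (hπ : M.IsPolicy π) {h : ℕ} (hh : h ≤ M.horizon) {s : S}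
    (hs : s ∈ M.states h) : M.stateValue π h s = M.bellmanValue π (M.horizon - h) h s := by
  rw [stateValue, value_eq_sum_bellmanValue hπ hh]
  · simp [Pi.single_apply]
  · intro s' hs'
    rcases eq_or_ne s' s with rfl | hne
    · exact hs
    · simp [hne] at hs'
  · simp

lemma occupancy_nonneg {M : FiniteHorizonMDP S A} {π : ℕ → S → A → ℝ} {μ : S → ℝ}
    (hπ : ∀ h s a, 0 ≤ π h s a) (hμ : ∀ s, 0 ≤ μ s) (h : ℕ) (s : S) :
    0 ≤ M.occupancy π μ h s := by
  induction h generalizing s with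
  | zero => exact hμ s
  | succ h ih =>
    exact sum_nonneg fun s' _ => sum_nonneg fun a _ =>
      mul_nonneg (mul_nonneg (ih s') (hπ _ _ _)) (M.p_nonneg _ _ _)

lemma sum_occupancy_le_one {M : FiniteHorizonMDP S A} {π : ℕ → S → A → ℝ} {μ : S → ℝ}
    (hπ : ∀ h s a, 0 ≤ π h s a) (hπ1 : ∀ h s, ∑ a, π h s a ≤ 1) (hμ : μ ∈ stdSimplex ℝ S)
    (h : ℕ) : ∑ s, M.occupancy π μ h s ≤ 1 := by
  induction h with
  | zero => exact hμ.2.le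
  | succ h ih =>
    refine le_trans ?_ ih
    simp only [occupancy]
    rw [sum_comm]
    refine sum_le_sum fun s _ => ?_
    rw [sum_comm]
    simp only [← mul_sum, (M.p_mem s _).2, mul_one]
    exact mul_le_of_le_one_right (occupancy_nonneg hπ hμ.1 h s) (hπ1 h s)

lemma bellmanValue_congr (M : FiniteHorizonMDP S A) {π π' : ℕ → S → A → ℝ} (n h : ℕ)
    (hπ : ∀ k ≥ h, π' k = π k) (s : S) : M.bellmanValue π' n h s = M.bellmanValue π n h s := by
  induction n generalizing h s with
  | zero => rfl
  | succ n ih =>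
    simp only [bellmanValue, hπ h le_rfl, ih (h + 1) fun k hk => hπ k (by omega)]

/-- Two policies that agree before epoch `h` differ in value only through what happens from epoch
`h` on, weighted by the common occupancy at epoch `h`. -/
lemma sum_bellmanValue_sub_of_agree_before (M : FiniteHorizonMDP S A) {π π' : ℕ → S → A → ℝ}
    (μ : S → ℝ) (m h : ℕ) (hπ : ∀ k < h, π' k = π k) :
    ∑ s, μ s * M.bellmanValue π' (m + h) 0 s - ∑ s, μ s * M.bellmanValue π (m + h) 0 s =
      ∑ s, M.occupancy π μ h s * (M.bellmanValue π' m h s - M.bellmanValue π m h s) := by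
  induction h generalizing m with
  | zero => simp [occupancy, mul_sub]
  | succ h ih =>
    rw [show m + (h + 1) = m + 1 + h by ring, ih (m + 1) fun k hk => hπ k (by omega)]
    simp only [occupancy, sum_mul]
    rw [sum_comm]
    refine sum_congr rfl fun s _ => ?_
    rw [bellmanValue_succ, bellmanValue_succ, hπ h (by omega), ← sum_sub_distrib, mul_sum, sum_comm]
    refine sum_congr rfl fun a _ => ?_
    rw [actionValue, actionValue, ← mul_sub, add_sub_add_left_eq_sub, ← sum_sub_distrib, mul_sum,
      mul_sum]
    refine sum_congr rfl fun s' _ => ?_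
    ring

/-- The exact change of the value when the policy is changed at the single epoch `h`. -/
lemma sum_bellmanValue_sub_of_agree_ne (M : FiniteHorizonMDP S A) {π π' : ℕ → S → A → ℝ}
    (μ : S → ℝ) (m h : ℕ) (hπ : ∀ k ≠ h, π' k = π k) :
    ∑ s, μ s * M.bellmanValue π' (m + 1 + h) 0 s -
        ∑ s, μ s * M.bellmanValue π (m + 1 + h) 0 s =
      ∑ s, M.occupancy π μ h s * ∑ a, (π' h s a - π h s a) * M.actionValue π m h s a := by
  rw [sum_bellmanValue_sub_of_agree_before M μ (m + 1) h fun k hk => hπ k hk.ne]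
  refine sum_congr rfl fun s _ => ?_
  rw [bellmanValue_succ, bellmanValue_succ, ← sum_sub_distrib]
  congr 1
  refine sum_congr rfl fun a _ => ?_
  have : M.actionValue π' m h s a = M.actionValue π m h s a := by
    simp only [actionValue, M.bellmanValue_congr m (h + 1) fun k hk => hπ k (by omega)]
  rw [this, sub_mul]

/-- A bound on the rewards, including those at inadmissible actions. -/
def rewardBound (M : FiniteHorizonMDP S A) : ℝ := ∑ s, ∑ a, |M.reward s a|

lemma rewardBound_nonneg (M : FiniteHorizonMDP S A) : 0 ≤ M.rewardBound :=
  sum_nonneg fun _ _ => sum_nonneg fun _ _ => abs_nonneg _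

lemma abs_reward_le (M : FiniteHorizonMDP S A) (s : S) (a : A) :
    |M.reward s a| ≤ M.rewardBound :=
  (single_le_sum (f := fun a => |M.reward s a|) (fun _ _ => abs_nonneg _) (mem_univ a)).trans
    (single_le_sum (f := fun s => ∑ a, |M.reward s a|)
      (fun _ _ => sum_nonneg fun _ _ => abs_nonneg _) (mem_univ s))

lemma abs_actionValue_le_of_abs_bellmanValue_le {M : FiniteHorizonMDP S A}
    {π : ℕ → S → A → ℝ} {n h : ℕ}
    (hV : ∀ s, |M.bellmanValue π n (h + 1) s| ≤ n * M.rewardBound) (s : S) (a : A) :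
    |M.actionValue π n h s a| ≤ (n + 1) * M.rewardBound := by
  refine (abs_add_le _ _).trans ?_
  have := M.abs_reward_le s a
  have := M.abs_sum_p_mul_le s a hV
  linarith

lemma abs_bellmanValue_le {M : FiniteHorizonMDP S A} {π : ℕ → S → A → ℝ}
    (hπ : ∀ h s a, 0 ≤ π h s a) (hπ1 : ∀ h s, ∑ a, π h s a ≤ 1) (n h : ℕ) (s : S) :
    |M.bellmanValue π n h s| ≤ n * M.rewardBound := by
  induction n generalizing h s with
  | zero => simp [bellmanValue]
  | succ n ih =>
    have hB : 0 ≤ ((n : ℝ) + 1) * M.rewardBound := mul_nonneg (by positivity) M.rewardBound_nonneg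
    rw [bellmanValue_succ]
    push_cast
    calc |∑ a, π h s a * M.actionValue π n h s a|
        ≤ ∑ a, π h s a * ((n + 1) * M.rewardBound) := by
          refine (abs_sum_le_sum_abs _ _).trans (sum_le_sum fun a _ => ?_)
          rw [abs_mul, abs_of_nonneg (hπ h s a)]
          exact mul_le_mul_of_nonneg_left
            (abs_actionValue_le_of_abs_bellmanValue_le (ih (h + 1)) s a) (hπ h s a)
      _ ≤ (n + 1) * M.rewardBound := by
          rw [← sum_mul]
          exact mul_le_of_le_one_left hB (hπ1 h s)

lemma abs_actionValue_le {M : FiniteHorizonMDP S A} {π : ℕ → S → A → ℝ}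
    (hπ : ∀ h s a, 0 ≤ π h s a) (hπ1 : ∀ h s, ∑ a, π h s a ≤ 1) (n h : ℕ) (s : S) (a : A) :
    |M.actionValue π n h s a| ≤ (n + 1) * M.rewardBound :=
  abs_actionValue_le_of_abs_bellmanValue_le (abs_bellmanValue_le hπ hπ1 n (h + 1)) s a

lemma reachable_of_trajProb_ne_zero {M : FiniteHorizonMDP S A} {π : ℕ → S → A → ℝ}
    (hπ : M.IsPolicy π) {n h : ℕ} (hn : h + n = M.horizon) {ν : S → ℝ}
    (hν : 0 < n → ∀ s, ν s ≠ 0 → M.Reachable h s) {τ : Fin n → S × A}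
    (hτ : M.trajProb π n h ν τ ≠ 0) (k : Fin n) :
    M.Reachable (h + k) (τ k).1 := by
  induction n generalizing h ν with
  | zero => exact k.elim0
  | succ n ih =>
    rw [trajProb] at hτ
    have hr := hν n.succ_pos _ (left_ne_zero_of_mul (left_ne_zero_of_mul hτ))
    have ha := hπ.mem_actions_of_ne_zero (by omega) hr.mem_states
      (right_ne_zero_of_mul (left_ne_zero_of_mul hτ))
    induction k using Fin.cases with
    | zero => exact hr
    | succ k =>
      have := ih (by omega) (fun hpos s hs => hr.step (by omega) ha hs)
        (right_ne_zero_of_mul hτ) k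
      rwa [show h + (k.succ : ℕ) = h + 1 + k by rw [Fin.val_succ]; ring]

lemma reachable_of_visitProb_pos [DecidableEq S] {M : FiniteHorizonMDP S A} {μ : S → ℝ}
    (hμ_zero : ∀ s ∉ M.states 0, μ s = 0) {π : ℕ → S → A → ℝ} (hπ : M.IsPolicy π)
    {h : Fin M.horizon} {s : S} (hv : 0 < M.visitProb π μ h s) : M.Reachable h s := by
  obtain ⟨τ, -, hτ⟩ := exists_ne_zero_of_sum_ne_zero hv.ne'
  obtain ⟨rfl, hne⟩ := ite_ne_right_iff.1 hτ
  simpa using reachable_of_trajProb_ne_zero hπ (Nat.zero_add _)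
    (fun _ s hs => .init (by_contra fun hcon => hs (hμ_zero s hcon))) hne h

end Bellman

/-! ### Softmax policies and the policy gradient formula -/

section Softmax

variable {S A : Type*} [Fintype S] [DecidableEq S] [Fintype A] [DecidableEq A]
  {M : FiniteHorizonMDP S A}

lemma mem_paramIndex {h : ℕ} {s : S} {a : A} :
    (h, s, a) ∈ M.paramIndex ↔ h < M.horizon ∧ s ∈ M.states h ∧ a ∈ M.actions s := by
  simp [paramIndex]

/-- The parameter `θ(s_h, a)` as a function on all of `A`, extended by `0`. -/
def logit (M : FiniteHorizonMDP S A) (θ : M.Param) (h : ℕ) (s : S) (a : A) : ℝ :=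
  if hx : (h, s, a) ∈ M.paramIndex then θ ⟨(h, s, a), hx⟩ else 0

lemma expWeight_eq_exp_logit (θ : M.Param) {h : ℕ} (hh : h < M.horizon) {s : S}
    (hs : s ∈ M.states h) {a : A} (ha : a ∈ M.actions s) :
    M.expWeight θ h s a = Real.exp (M.logit θ h s a) := by
  have hx := mem_paramIndex.2 ⟨hh, hs, ha⟩
  rw [expWeight, logit, dif_pos hx, dif_pos hx]

lemma expWeight_eq_zero (θ : M.Param) {h : ℕ} {s : S} {a : A} (hx : (h, s, a) ∉ M.paramIndex) :
    M.expWeight θ h s a = 0 := dif_neg hx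

lemma expWeight_nonneg (θ : M.Param) (h : ℕ) (s : S) (a : A) : 0 ≤ M.expWeight θ h s a := by
  unfold expWeight
  split_ifs
  exacts [(Real.exp_pos _).le, le_rfl]

lemma sum_actions_expWeight (θ : M.Param) (h : ℕ) (s : S) :
    ∑ a ∈ M.actions s, M.expWeight θ h s a = ∑ a, M.expWeight θ h s a :=
  sum_subset (subset_univ _) fun _ _ ha =>
    expWeight_eq_zero θ fun hx => ha (mem_paramIndex.1 hx).2.2

lemma sum_expWeight_pos (θ : M.Param) {h : ℕ} (hh : h < M.horizon) {s : S}
    (hs : s ∈ M.states h) : 0 < ∑ a, M.expWeight θ h s a := by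
  rw [← sum_actions_expWeight]
  refine sum_pos (fun a ha => ?_) (M.actions_nonempty s)
  rw [expWeight_eq_exp_logit θ hh hs ha]
  exact Real.exp_pos _

lemma softmax_eq (θ : M.Param) (h : ℕ) (s : S) (a : A) :
    M.softmax θ h s a = M.expWeight θ h s a / ∑ a', M.expWeight θ h s a' := by
  rw [softmax, sum_actions_expWeight]

lemma softmax_eq_gibbs (θ : M.Param) {h : ℕ} (hh : h < M.horizon) {s : S}
    (hs : s ∈ M.states h) {a : A} (ha : a ∈ M.actions s) :
    M.softmax θ h s a = gibbs (M.actions s) (M.logit θ h s) a := by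
  rw [softmax, gibbs, expWeight_eq_exp_logit θ hh hs ha,
    sum_congr rfl fun b hb => expWeight_eq_exp_logit θ hh hs hb]

lemma softmax_eq_zero (θ : M.Param) {h : ℕ} {s : S} {a : A} (hx : (h, s, a) ∉ M.paramIndex) :
    M.softmax θ h s a = 0 := by
  rw [softmax, expWeight_eq_zero θ hx, zero_div]

lemma softmax_nonneg (θ : M.Param) (h : ℕ) (s : S) (a : A) : 0 ≤ M.softmax θ h s a :=
  div_nonneg (expWeight_nonneg θ h s a) (sum_nonneg fun _ _ => expWeight_nonneg θ h s _)

lemma sum_softmax_eq_one (θ : M.Param) {h : ℕ} (hh : h < M.horizon) {s : S}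
    (hs : s ∈ M.states h) : ∑ a, M.softmax θ h s a = 1 := by
  simp only [softmax_eq, ← sum_div]
  exact div_self (sum_expWeight_pos θ hh hs).ne'

/-- At states outside the enlarged state space the softmax weights all vanish. -/
lemma sum_softmax_le_one (θ : M.Param) (h : ℕ) (s : S) : ∑ a, M.softmax θ h s a ≤ 1 := by
  simp only [softmax_eq, ← sum_div]
  exact div_self_le_one _

lemma sum_softmax_mul (θ : M.Param) (h : ℕ) (s : S) (f : A → ℝ) :
    ∑ a, M.softmax θ h s a * f a = ∑ a ∈ M.actions s, M.softmax θ h s a * f a :=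
  (sum_subset (subset_univ _) fun a _ ha => by
    rw [softmax_eq_zero θ fun hx => ha (mem_paramIndex.1 hx).2.2, zero_mul]).symm

lemma sum_gibbs_logit_mul (θ : M.Param) {h : ℕ} (hh : h < M.horizon) {s : S}
    (hs : s ∈ M.states h) (f : A → ℝ) :
    ∑ a ∈ M.actions s, gibbs (M.actions s) (M.logit θ h s) a * f a =
      ∑ a, M.softmax θ h s a * f a := by
  rw [sum_softmax_mul]
  exact sum_congr rfl fun a ha => by rw [softmax_eq_gibbs θ hh hs ha]

lemma isPolicy_softmax (θ : M.Param) : M.IsPolicy (M.softmax θ) := by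
  intro h hh s hs
  refine ⟨⟨softmax_nonneg θ h s, sum_softmax_eq_one θ hh hs⟩, ?_⟩
  have := sum_softmax_mul θ h s fun _ => 1
  simp only [mul_one] at this
  rw [← this, sum_softmax_eq_one θ hh hs]

lemma differentiable_expWeight (h : ℕ) (s : S) (a : A) :
    Differentiable ℝ fun θ : M.Param => M.expWeight θ h s a := by
  unfold expWeight
  split_ifs with hx
  · fun_prop
  · fun_prop

lemma differentiable_softmax (h : ℕ) (s : S) (a : A) :
    Differentiable ℝ fun θ : M.Param => M.softmax θ h s a := by
  by_cases hx : (h, s, a) ∈ M.paramIndex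
  · obtain ⟨hh, hs, -⟩ := mem_paramIndex.1 hx
    simp only [softmax_eq, div_eq_mul_inv]
    exact (differentiable_expWeight h s a).fun_mul
      (Differentiable.fun_inv (Differentiable.fun_sum fun b _ => differentiable_expWeight h s b)
        fun θ => (sum_expWeight_pos θ hh hs).ne')
  · simp only [softmax_eq_zero _ hx]
    fun_prop

lemma differentiable_bellmanValue_softmax (n h : ℕ) (s : S) :
    Differentiable ℝ fun θ : M.Param => M.bellmanValue (M.softmax θ) n h s := by
  induction n generalizing h s with
  | zero => exact differentiable_const _
  | succ n ih =>
    refine Differentiable.fun_sum fun a _ => (differentiable_softmax h s a).fun_mul ?_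
    exact (differentiable_const _).fun_add
      (Differentiable.fun_sum fun s' _ => (differentiable_const _).fun_mul (ih (h + 1) s'))

lemma value_softmax_eq {μ : S → ℝ} (hμ : μ ∈ stdSimplex ℝ S)
    (hμ_zero : ∀ s ∉ M.states 0, μ s = 0) (θ : M.Param) :
    M.value (M.softmax θ) 0 μ = ∑ s, μ s * M.bellmanValue (M.softmax θ) M.horizon 0 s :=
  value_eq_sum_bellmanValue (isPolicy_softmax θ) (Nat.zero_le _)
    (fun s hs => by_contra fun hcon => hs (hμ_zero s hcon)) hμ.2

lemma gradient_apply_eq_of_hasDerivAt {ι : Type*} [Fintype ι] [DecidableEq ι]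
    {f : EuclideanSpace ℝ ι → ℝ} {x : EuclideanSpace ℝ ι} (hf : DifferentiableAt ℝ f x) {i : ι}
    {d : ℝ} (hd : HasDerivAt (fun t : ℝ => f (x + t • EuclideanSpace.single i 1)) d 0) :
    gradient f x i = d := by
  have h1 : HasDerivAt (fun t : ℝ => f (x + t • EuclideanSpace.single i 1))
      (fderiv ℝ f x (EuclideanSpace.single i 1)) 0 := hf.hasFDerivAt.hasLineDerivAt _
  rw [hd.unique h1, ← toDual_gradient, InnerProductSpace.toDual_apply_apply,
    EuclideanSpace.inner_single_right]
  simp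

lemma expWeight_add_smul_single (θ : M.Param) (t : ℝ) {h : ℕ} {s : S} {a : A}
    (hx : (h, s, a) ∈ M.paramIndex) (k : ℕ) (s' : S) (b : A) :
    M.expWeight (θ + t • EuclideanSpace.single ⟨(h, s, a), hx⟩ 1) k s' b =
      M.expWeight θ k s' b * if (k, s', b) = (h, s, a) then Real.exp t else 1 := by
  unfold expWeight
  split_ifs with h1 h2 h2
  · simp [h2, Real.exp_add]
  · simp [h2]
  · simp
  · simp

/-- The policy gradient formula: the partial derivative of the value with respect to `θ(s_h, a)` is
the probability of visiting `s` at epoch `h`, times the probability of `a`, times the advantage of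
`a`. -/
lemma gradient_value_softmax {μ : S → ℝ} (hμ : μ ∈ stdSimplex ℝ S)
    (hμ_zero : ∀ s ∉ M.states 0, μ s = 0) (θ : M.Param) {h m : ℕ} (hm : m + 1 + h = M.horizon)
    {s : S} {a : A} (hx : (h, s, a) ∈ M.paramIndex) :
    gradient (fun θ : M.Param => M.value (M.softmax θ) 0 μ) θ ⟨(h, s, a), hx⟩ =
      M.occupancy (M.softmax θ) μ h s * (M.softmax θ h s a *
        (M.actionValue (M.softmax θ) m h s a - M.bellmanValue (M.softmax θ) (m + 1) h s)) := by
  simp only [value_softmax_eq hμ hμ_zero]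
  refine gradient_apply_eq_of_hasDerivAt ?_ ?_
  · exact (Differentiable.fun_sum fun s _ => (differentiable_const _).fun_mul
      (differentiable_bellmanValue_softmax _ 0 s)) θ
  obtain ⟨hh, hs, ha⟩ := mem_paramIndex.1 hx
  set e : M.Param := EuclideanSpace.single ⟨(h, s, a), hx⟩ 1 with he
  set Q := M.actionValue (M.softmax θ) m h s with hQ
  set d := M.occupancy (M.softmax θ) μ h s with hd
  -- moving along the coordinate `(s_h, a)` changes the policy at `s_h` only
  have hw : ∀ (t : ℝ) k s' b, (k, s') ≠ (h, s) →
      M.expWeight (θ + t • e) k s' b = M.expWeight θ k s' b := by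
    intro t k s' b hne
    rw [he, expWeight_add_smul_single, if_neg, mul_one]
    intro heq
    simp only [Prod.mk.injEq] at heq
    exact hne (by rw [heq.1, heq.2.1])
  have hsm : ∀ (t : ℝ) k s' b, (k, s') ≠ (h, s) →
      M.softmax (θ + t • e) k s' b = M.softmax θ k s' b := by
    intro t k s' b hne
    simp only [softmax_eq, hw t k s' _ hne]
  have hline : ∀ t : ℝ, ∑ s', μ s' * M.bellmanValue (M.softmax (θ + t • e)) M.horizon 0 s' =
      ∑ s', μ s' * M.bellmanValue (M.softmax θ) M.horizon 0 s' +
        d * ((∑ b, M.expWeight (θ + t • e) h s b * Q b) / (∑ b, M.expWeight (θ + t • e) h s b) -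
          ∑ b, M.softmax θ h s b * Q b) := by
    intro t
    have h1 := M.sum_bellmanValue_sub_of_agree_ne (π := M.softmax θ)
      (π' := M.softmax (θ + t • e)) μ m h fun k hk => by
        funext s' b
        exact hsm t k s' b fun heq => hk (Prod.mk.inj heq).1
    rw [hm, sub_eq_iff_eq_add'] at h1
    rw [h1]
    congr 1
    rw [sum_eq_single s]
    · simp only [sub_mul, sum_sub_distrib, softmax_eq (θ + t • e), div_mul_eq_mul_div, ← sum_div]
      rfl
    · intro s' _ hne
      rw [sum_eq_zero, mul_zero]
      intro b _
      rw [hsm t h s' b fun heq => hne (Prod.mk.inj heq).2, sub_self, zero_mul]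
    · simp
  simp only [hline]
  have hwd : ∀ b, HasDerivAt (fun t : ℝ => M.expWeight (θ + t • e) h s b)
      (if b = a then M.expWeight θ h s a else 0) 0 := by
    intro b
    simp only [he, expWeight_add_smul_single]
    by_cases hb : b = a
    · subst hb
      simpa using (Real.hasDerivAt_exp 0).const_mul (M.expWeight θ h s b)
    · simpa [hb] using hasDerivAt_const (0 : ℝ) (M.expWeight θ h s b)
  have hS := (sum_expWeight_pos θ hh hs).ne'
  have hden := HasDerivAt.fun_sum fun b (_ : b ∈ (univ : Finset A)) => hwd b
  have hnum := HasDerivAt.fun_sum fun b (_ : b ∈ (univ : Finset A)) => (hwd b).mul_const (Q b)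
  have hdiv := (((hnum.fun_div hden (by simpa using hS)).sub_const
    (∑ b, M.softmax θ h s b * Q b)).const_mul d).const_add
      (∑ s', μ s' * M.bellmanValue (M.softmax θ) M.horizon 0 s')
  refine hdiv.congr_deriv ?_
  simp only [zero_smul, add_zero, ite_mul, zero_mul, sum_ite_eq', mem_univ, if_true]
  rw [bellmanValue_succ, ← hQ]
  simp only [softmax_eq, div_mul_eq_mul_div, ← sum_div]
  field_simp

end Softmax

/-! ### Convergence of simultaneous policy gradient -/

section PolicyGradient

variable {S A : Type*} [Fintype S] [DecidableEq S] [Fintype A] [DecidableEq A]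
  {M : FiniteHorizonMDP S A} {μ : S → ℝ} {η : ℝ} {θ₀ : M.Param}

lemma logit_simultaneousPG_succ (hμ : μ ∈ stdSimplex ℝ S) (hμ_zero : ∀ s ∉ M.states 0, μ s = 0)
    (n : ℕ) {h m : ℕ} (hm : m + 1 + h = M.horizon) {s : S} (hs : s ∈ M.states h) {a : A}
    (ha : a ∈ M.actions s) :
    M.logit (M.simultaneousPG η μ θ₀ (n + 1)) h s a =
      M.logit (M.simultaneousPG η μ θ₀ n) h s a +
        η * M.occupancy (M.softmax (M.simultaneousPG η μ θ₀ n)) μ h s *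
          (gibbs (M.actions s) (M.logit (M.simultaneousPG η μ θ₀ n) h s) a *
            (M.actionValue (M.softmax (M.simultaneousPG η μ θ₀ n)) m h s a -
              M.bellmanValue (M.softmax (M.simultaneousPG η μ θ₀ n)) (m + 1) h s)) := by
  have hh : h < M.horizon := by omega
  have hx := mem_paramIndex.2 ⟨hh, hs, ha⟩
  rw [logit, dif_pos hx, logit, dif_pos hx, simultaneousPG, PiLp.add_apply, PiLp.smul_apply,
    gradient_value_softmax hμ hμ_zero _ hm hx, softmax_eq_gibbs _ hh hs ha, smul_eq_mul, mul_assoc]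

lemma sum_gibbs_mul_advantage (θ : M.Param) {h m : ℕ} (hm : m + 1 + h = M.horizon) {s : S}
    (hs : s ∈ M.states h) :
    ∑ a ∈ M.actions s, gibbs (M.actions s) (M.logit θ h s) a *
      (M.actionValue (M.softmax θ) m h s a - M.bellmanValue (M.softmax θ) (m + 1) h s) = 0 := by
  have hh : h < M.horizon := by omega
  rw [sum_gibbs_logit_mul θ hh hs]
  simp only [mul_sub, sum_sub_distrib, ← sum_mul]
  rw [sum_softmax_eq_one θ hh hs, one_mul, bellmanValue_succ, sub_self]

/-- All values improve monotonically along the iteration, for every step size: by backward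
induction it is enough to improve the expected action value at each state separately. -/
lemma bellmanValue_simultaneousPG_le_succ (hμ : μ ∈ stdSimplex ℝ S)
    (hμ_zero : ∀ s ∉ M.states 0, μ s = 0) (hη : 0 ≤ η) (n : ℕ) {m h : ℕ}
    (hm : m + h = M.horizon) (s : S) :
    M.bellmanValue (M.softmax (M.simultaneousPG η μ θ₀ n)) m h s ≤
      M.bellmanValue (M.softmax (M.simultaneousPG η μ θ₀ (n + 1))) m h s := by
  induction m generalizing h s with
  | zero => exact le_rfl
  | succ m ih =>
    by_cases hs : s ∈ M.states h
    · have hh : h < M.horizon := by omega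
      set θ := M.simultaneousPG η μ θ₀ n with hθ
      set θ' := M.simultaneousPG η μ θ₀ (n + 1) with hθ'
      have h1 := sum_gibbs_step_mul_nonneg (M.actions_nonempty s)
        (mul_nonneg hη (occupancy_nonneg (softmax_nonneg θ) hμ.1 h s))
        (fun a ha => logit_simultaneousPG_succ (η := η) (θ₀ := θ₀) hμ hμ_zero n hm hs ha)
        (sum_gibbs_mul_advantage θ hm hs)
      rw [← hθ', sum_gibbs_logit_mul θ' hh hs] at h1
      simp only [mul_sub, sum_sub_distrib, ← sum_mul] at h1
      rw [sum_softmax_eq_one θ' hh hs, one_mul, sub_nonneg] at h1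
      refine h1.trans (sum_le_sum fun a _ => mul_le_mul_of_nonneg_left ?_ (softmax_nonneg θ' h s a))
      exact add_le_add_right (sum_le_sum fun s' _ =>
        mul_le_mul_of_nonneg_left (ih (by omega) s') (M.p_nonneg s a s')) _
    · have h0 : ∀ θ : M.Param, M.bellmanValue (M.softmax θ) (m + 1) h s = 0 := fun θ => by
        rw [bellmanValue_succ]
        exact sum_eq_zero fun a _ => by
          rw [softmax_eq_zero θ fun hx => hs (mem_paramIndex.1 hx).2.1, zero_mul]
      rw [h0, h0]

/-- The limit of the values along the iteration, as a supremum. -/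
def limitValue (M : FiniteHorizonMDP S A) (η : ℝ) (μ : S → ℝ) (θ₀ : M.Param) (m h : ℕ) (s : S) :
    ℝ :=
  ⨆ n, M.bellmanValue (M.softmax (M.simultaneousPG η μ θ₀ n)) m h s

lemma tendsto_bellmanValue_limitValue (hμ : μ ∈ stdSimplex ℝ S)
    (hμ_zero : ∀ s ∉ M.states 0, μ s = 0) (hη : 0 ≤ η) {m h : ℕ} (hm : m + h = M.horizon) (s : S) :
    Filter.Tendsto (fun n => M.bellmanValue (M.softmax (M.simultaneousPG η μ θ₀ n)) m h s)
      Filter.atTop (nhds (M.limitValue η μ θ₀ m h s)) := by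
  refine tendsto_atTop_ciSup
    (monotone_nat_of_le_succ fun n => bellmanValue_simultaneousPG_le_succ hμ hμ_zero hη n hm s)
    ⟨m * M.rewardBound, ?_⟩
  rintro _ ⟨n, rfl⟩
  exact (abs_le.1 (abs_bellmanValue_le (softmax_nonneg _) (sum_softmax_le_one _) m h s)).2

lemma occupancy_le_one {θ : M.Param} (hμ : μ ∈ stdSimplex ℝ S) (h : ℕ) (s : S) :
    M.occupancy (M.softmax θ) μ h s ≤ 1 :=
  (single_le_sum (f := M.occupancy (M.softmax θ) μ h)
    (fun s _ => occupancy_nonneg (softmax_nonneg θ) hμ.1 h s) (mem_univ s)).trans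
    (sum_occupancy_le_one (softmax_nonneg θ) (sum_softmax_le_one θ) hμ h)

lemma abs_advantage_le (θ : M.Param) (m h : ℕ) (s : S) (a : A) :
    |M.actionValue (M.softmax θ) m h s a - M.bellmanValue (M.softmax θ) (m + 1) h s| ≤
      2 * ((m + 1) * M.rewardBound) := by
  have h1 := abs_actionValue_le (M := M) (softmax_nonneg θ) (sum_softmax_le_one θ) m h s a
  have h2 := abs_bellmanValue_le (M := M) (softmax_nonneg θ) (sum_softmax_le_one θ) (m + 1) h s
  push_cast at h2
  linarith [abs_sub (M.actionValue (M.softmax θ) m h s a)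
    (M.bellmanValue (M.softmax θ) (m + 1) h s)]

/-- Reachable states are visited with non-summable probability, although the probability itself may
tend to `0`: at a state with this property every admissible action is explored with non-summable
weight, so the property passes to its successors. -/
lemma not_summable_occupancy (hμ : μ ∈ stdSimplex ℝ S) (hμ_pos : ∀ s ∈ M.states 0, 0 < μ s)
    (hμ_zero : ∀ s ∉ M.states 0, μ s = 0) (hη : 0 < η) {h : ℕ} {s : S} (hr : M.Reachable h s) :
    ¬ Summable fun n => η * M.occupancy (M.softmax (M.simultaneousPG η μ θ₀ n)) μ h s := by
  induction hr with
  | @init s hs =>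
    simp only [occupancy]
    rw [summable_const_iff]
    exact (mul_pos hη (hμ_pos s hs)).ne'
  | @step h s s' a hr hh ha hp ih =>
    intro hsum
    obtain ⟨m, hm⟩ : ∃ m, m + 1 + h = M.horizon := ⟨M.horizon - h - 1, by omega⟩
    have hs := hr.mem_states
    refine not_summable_mul_gibbs (F := M.actions s)
      (θ := fun n => M.logit (M.simultaneousPG η μ θ₀ n) h s)
      (fun n => mul_nonneg hη.le (occupancy_nonneg (softmax_nonneg _) hμ.1 h s))
      (fun n => mul_le_mul_of_nonneg_left (occupancy_le_one hμ h s) hη.le)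
      (fun n b _ => abs_advantage_le (M.simultaneousPG η μ θ₀ n) m h s b)
      (fun n b hb => logit_simultaneousPG_succ hμ hμ_zero n hm hs hb)
      (fun n => sum_gibbs_mul_advantage _ hm hs) ih ha ?_
    have hp0 : 0 < M.p s a s' := (M.p_nonneg s a s').lt_of_ne' hp
    refine Summable.of_nonneg_of_le (fun n => ?_) (fun n => ?_) (hsum.mul_left (M.p s a s')⁻¹)
    · exact mul_nonneg (mul_nonneg hη.le (occupancy_nonneg (softmax_nonneg _) hμ.1 h s))
        (gibbs_pos ⟨a, ha⟩ _ _).le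
    · set θ := M.simultaneousPG η μ θ₀ n
      have hterm : ∀ x b, 0 ≤ M.occupancy (M.softmax θ) μ h x * M.softmax θ h x b * M.p x b s' :=
        fun x b => mul_nonneg (mul_nonneg (occupancy_nonneg (softmax_nonneg θ) hμ.1 h x)
          (softmax_nonneg θ h x b)) (M.p_nonneg x b s')
      have h1 : M.occupancy (M.softmax θ) μ h s * M.softmax θ h s a * M.p s a s' ≤
          M.occupancy (M.softmax θ) μ (h + 1) s' :=
        (single_le_sum (f := fun b => M.occupancy (M.softmax θ) μ h s * M.softmax θ h s b *
          M.p s b s') (fun b _ => hterm s b) (mem_univ a)).trans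
        (single_le_sum (f := fun x => ∑ b, M.occupancy (M.softmax θ) μ h x * M.softmax θ h x b *
          M.p x b s') (fun x _ => sum_nonneg fun b _ => hterm x b) (mem_univ s))
      rw [softmax_eq_gibbs θ (by omega) hs ha] at h1
      have h2 := mul_le_mul_of_nonneg_left h1 hη.le
      rw [inv_mul_eq_div, le_div_iff₀ hp0]
      linarith

/-- The limit values satisfy the Bellman optimality inequality at reachable states. -/
lemma reward_add_limitValue_le (hμ : μ ∈ stdSimplex ℝ S) (hμ_pos : ∀ s ∈ M.states 0, 0 < μ s)
    (hμ_zero : ∀ s ∉ M.states 0, μ s = 0) (hη : 0 < η) {m h : ℕ} (hm : m + 1 + h = M.horizon)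
    {s : S} (hr : M.Reachable h s) {a : A} (ha : a ∈ M.actions s) :
    M.reward s a + ∑ s', M.p s a s' * M.limitValue η μ θ₀ m (h + 1) s' ≤
      M.limitValue η μ θ₀ (m + 1) h s := by
  have hs := hr.mem_states
  have hlim : ∀ b ∈ M.actions s, Filter.Tendsto
      (fun n => M.actionValue (M.softmax (M.simultaneousPG η μ θ₀ n)) m h s b -
        M.bellmanValue (M.softmax (M.simultaneousPG η μ θ₀ n)) (m + 1) h s) Filter.atTop
      (nhds (M.reward s b + ∑ s', M.p s b s' * M.limitValue η μ θ₀ m (h + 1) s' -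
        M.limitValue η μ θ₀ (m + 1) h s)) := fun b _ =>
    ((tendsto_finsetSum _ fun s' _ =>
      (tendsto_bellmanValue_limitValue hμ hμ_zero hη.le (by omega) s').const_mul _).const_add
        _).sub (tendsto_bellmanValue_limitValue hμ hμ_zero hη.le hm s)
  exact sub_nonpos.1 (limit_advantage_nonpos
    (θ := fun n => M.logit (M.simultaneousPG η μ θ₀ n) h s)
    (fun n => mul_nonneg hη.le (occupancy_nonneg (softmax_nonneg _) hμ.1 h s))
    (fun n => mul_le_mul_of_nonneg_left (occupancy_le_one hμ h s) hη.le)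
    (fun n b _ => abs_advantage_le (M.simultaneousPG η μ θ₀ n) m h s b)
    (fun n b hb => logit_simultaneousPG_succ hμ hμ_zero n hm hs hb)
    (fun n => sum_gibbs_mul_advantage _ hm hs)
    (not_summable_occupancy hμ hμ_pos hμ_zero hη hr) hlim ha)

lemma bellmanValue_le_limitValue (hμ : μ ∈ stdSimplex ℝ S) (hμ_pos : ∀ s ∈ M.states 0, 0 < μ s)
    (hμ_zero : ∀ s ∉ M.states 0, μ s = 0) (hη : 0 < η) {π : ℕ → S → A → ℝ} (hπ : M.IsPolicy π)
    {m h : ℕ} (hm : m + h = M.horizon) {s : S} (hr : 0 < m → M.Reachable h s) :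
    M.bellmanValue π m h s ≤ M.limitValue η μ θ₀ m h s := by
  induction m generalizing h s with
  | zero => simp [limitValue, bellmanValue]
  | succ m ih =>
    have hr := hr m.succ_pos
    have hh : h < M.horizon := by omega
    obtain ⟨⟨hπ0, hπ1⟩, -⟩ := hπ h hh s hr.mem_states
    rw [bellmanValue_succ]
    calc ∑ a, π h s a * M.actionValue π m h s a
        ≤ ∑ a, π h s a * M.limitValue η μ θ₀ (m + 1) h s := by
          refine sum_le_sum fun a _ => ?_
          by_cases hne : π h s a = 0
          · rw [hne, zero_mul, zero_mul]
          have ha := hπ.mem_actions_of_ne_zero hh hr.mem_states hne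
          refine mul_le_mul_of_nonneg_left (le_trans ?_
            (reward_add_limitValue_le hμ hμ_pos hμ_zero hη hm hr ha)) (hπ0 a)
          refine add_le_add_right (sum_le_sum fun s' _ => ?_) _
          by_cases hp : M.p s a s' = 0
          · rw [hp, zero_mul, zero_mul]
          · exact mul_le_mul_of_nonneg_left
              (ih (by omega) fun hpos => hr.step (by omega) ha hp) (M.p_nonneg s a s')
      _ = M.limitValue η μ θ₀ (m + 1) h s := by rw [← sum_mul, hπ1, one_mul]

lemma tendsto_stateValue_of_reachable (hμ : μ ∈ stdSimplex ℝ S)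
    (hμ_pos : ∀ s ∈ M.states 0, 0 < μ s) (hμ_zero : ∀ s ∉ M.states 0, μ s = 0) (hη : 0 < η)
    {h : ℕ} (hh : h < M.horizon) {s : S} (hr : M.Reachable h s) :
    Filter.Tendsto (fun n => M.stateValue (M.softmax (M.simultaneousPG η μ θ₀ n)) h s)
      Filter.atTop (nhds (M.optimalValue h s)) := by
  have hm : M.horizon - h + h = M.horizon := by omega
  have hs := hr.mem_states
  have hlim := tendsto_bellmanValue_limitValue (θ₀ := θ₀) hμ hμ_zero hη.le hm s
  simp only [stateValue_eq_bellmanValue (isPolicy_softmax _) hh.le hs]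
  have hub : ∀ v ∈ {v | ∃ π : ℕ → S → A → ℝ, M.IsPolicy π ∧ v = M.stateValue π h s},
      v ≤ M.limitValue η μ θ₀ (M.horizon - h) h s := by
    rintro _ ⟨π, hπ, rfl⟩
    rw [stateValue_eq_bellmanValue hπ hh.le hs]
    exact bellmanValue_le_limitValue hμ hμ_pos hμ_zero hη hπ hm fun _ => hr
  have heq : M.optimalValue h s = M.limitValue η μ θ₀ (M.horizon - h) h s := by
    refine le_antisymm (csSup_le ⟨_, _, isPolicy_softmax θ₀, rfl⟩ hub)
      (le_of_tendsto' hlim fun n => le_csSup ⟨_, hub⟩ ?_)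
    exact ⟨_, isPolicy_softmax _, (stateValue_eq_bellmanValue (isPolicy_softmax _) hh.le hs).symm⟩
  rw [heq]
  exact hlim

end PolicyGradient

end FiniteHorizonMDP

end

theorem mainTheorem5 {S A : Type*} [Fintype S] [DecidableEq S] [Fintype A] [DecidableEq A]
    (M : FiniteHorizonMDP S A) (Rstar : ℝ) (hR : 0 < Rstar)
    (hreward : ∀ s, ∀ a ∈ M.actions s, M.reward s a ∈ Set.Icc 0 Rstar)
    (μ : S → ℝ) (hμ : μ ∈ stdSimplex ℝ S)
    (hμ_pos : ∀ s ∈ M.states 0, 0 < μ s) (hμ_zero : ∀ s ∉ M.states 0, μ s = 0)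
    (η : ℝ) (hη_pos : 0 < η) (hη_le : η ≤ 1 / (5 * (M.horizon : ℝ) ^ 2 * Rstar))
    (θ₀ : M.Param) :
    (∀ x ∈ M.enlargedStates,
      (∃ π : ℕ → S → A → ℝ, M.IsPolicy π ∧ 0 < M.visitProb π μ x.1 x.2) →
        Filter.Tendsto
          (fun n : ℕ => M.stateValue (M.softmax (M.simultaneousPG η μ θ₀ n)) x.1 x.2)
          Filter.atTop (nhds (M.optimalValue x.1 x.2))) ∧
    (∀ s ∈ M.states 0,
      Filter.Tendsto
        (fun n : ℕ => M.stateValue (M.softmax (M.simultaneousPG η μ θ₀ n)) 0 s)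
        Filter.atTop (nhds (M.optimalValue 0 s))) := by
  refine ⟨?_, fun s hs => ?_⟩
  · rintro x - ⟨π, hπ, hv⟩
    exact FiniteHorizonMDP.tendsto_stateValue_of_reachable hμ hμ_pos hμ_zero hη_pos x.1.2
      (FiniteHorizonMDP.reachable_of_visitProb_pos hμ_zero hπ hv)
  · exact FiniteHorizonMDP.tendsto_stateValue_of_reachable hμ hμ_pos hμ_zero hη_pos
      M.horizon_pos (.init hs)
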